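/- Fix $t\in\mathbb R$ and let $P_n(x;t)$, $n\ge 0$, be the monic polynomials of degree $n$ that are orthogonal on $\mathbb R$ with respect to the quartic Freud weight $w(x;t)=e^{-x^4+tx^2}$. Let $\mathrm p(n,t)$ be the coefficient of $x^{n-2}$ in $P_n(x;t)$ (with $\mathrm p(0,t)=\mathrm p(1,t)=0$), and let $\beta_n=\beta_n(t)$ be the recurrence coefficients in $xP_n=P_{n+1}+\beta_nP_{n-1}$, where $\beta_0=0$ and $\beta_0P_{-1}=0$. Then, for every $n\ge 1$, $$\mathrm p(n,t)=\tfrac12\beta_n+t\beta_n^2-2\beta_n(\beta_{n-1}+\beta_n)(\beta_n+\beta_{n+1}),$$ and, as $n\to\infty$ with $t$ fixed, $$\mathrm p(n,t)=-\frac{n^{3/2}}{3\sqrt3}-\frac{nt}{12}-\frac{(t^2-6)n^{1/2}}{24\sqrt3}-\frac{t(t^2-9)}{216}-\frac{t^4-12t^2-24}{1152\sqrt3\,n^{1/2}}+\frac{t}{288n}+\frac{t^6-18t^4-72t^2+864}{82944\sqrt3\,n^{3/2}}-\frac{t(t^2-6)}{3456n^2}+O\big(n^{-5/2}\big).$$ 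-/

import Mathlib

open Filter Asymptotics MeasureTheory Polynomial

noncomputable section

namespace Freud

/-- The quartic Freud weight `w(x; t) = exp (-x ^ 4 + t * x ^ 2)` on the real line. -/
def weight (t x : ℝ) : ℝ := Real.exp (-x ^ 4 + t * x ^ 2)

/-- The pairing `∫ p(x) q(x) w(x; t) dx` over the real line
(the integrand is always integrable, see `integrable_eval_mul_weight`). -/
def pairing (t : ℝ) (p q : ℝ[X]) : ℝ := ∫ x : ℝ, p.eval x * q.eval x * weight t x

/-- `P` is the sequence of monic orthogonal polynomials for the weight `w(x; t)`:
`P n` is monic of degree `n`, and different members are orthogonal. -/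
structure IsMonicOPS (t : ℝ) (P : ℕ → ℝ[X]) : Prop where
  monic : ∀ n, (P n).Monic
  natDegree_eq : ∀ n, (P n).natDegree = n
  orthogonal : ∀ j k, j ≠ k → pairing t (P j) (P k) = 0

/-- The nontrivial leading coefficient: the coefficient of `x ^ (n - 2)` in `P n`, which is `0`
for `n = 0` and `n = 1`. -/
def subleading (P : ℕ → ℝ[X]) (n : ℕ) : ℝ := if 2 ≤ n then (P n).coeff (n - 2) else 0

/-- The coefficients `β n` in the three-term recurrence
`x P n = P (n + 1) + β n P (n - 1)`, where `β 0 = 0` and the last term is absent for `n = 0`. -/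
structure IsRecurrenceCoeff (P : ℕ → ℝ[X]) (β : ℕ → ℝ) : Prop where
  zero : β 0 = 0
  first : X * P 0 = P 1
  succ : ∀ n, X * P (n + 1) = P (n + 2) + C (β (n + 1)) * P n

/-! The monic orthogonal polynomials exist. -/

theorem integrable_eval_mul_weight (t : ℝ) (p : ℝ[X]) :
    Integrable (fun x : ℝ => p.eval x * weight t x) := by
  induction p using Polynomial.induction_on' with
  | add p q hp hq =>
    simp only [eval_add, add_mul]
    exact hp.add hq
  | monomial n a =>
    have h1 : Integrable (fun x : ℝ => x ^ (n : ℝ) * Real.exp (-1 * x ^ 2)) :=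
      integrable_rpow_mul_exp_neg_mul_sq one_pos (by have := n.cast_nonneg (α := ℝ); linarith)
    have h2 := (h1.const_mul (a * Real.exp ((t + 1) ^ 2 / 4)))
    refine h2.mono (Continuous.aestronglyMeasurable (by unfold weight; fun_prop)) ?_
    refine Eventually.of_forall fun x => ?_
    have h3 : weight t x ≤ Real.exp ((t + 1) ^ 2 / 4) * Real.exp (-1 * x ^ 2) := by
      rw [← Real.exp_add]
      exact Real.exp_le_exp.2 (by nlinarith [sq_nonneg (x ^ 2 - (t + 1) / 2)])
    have h4 : 0 ≤ weight t x := (Real.exp_pos _).le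
    simp only [eval_monomial, Real.rpow_natCast, norm_mul, Real.norm_eq_abs, abs_of_nonneg h4,
      Real.abs_exp]
    calc |a| * |x ^ n| * weight t x
        ≤ |a| * |x ^ n| * (Real.exp ((t + 1) ^ 2 / 4) * Real.exp (-1 * x ^ 2)) := by gcongr
      _ = _ := by ring

theorem integrable_pairing (t : ℝ) (p q : ℝ[X]) :
    Integrable (fun x : ℝ => p.eval x * q.eval x * weight t x) := by
  simpa using integrable_eval_mul_weight t (p * q)

theorem pairing_comm (t : ℝ) (p q : ℝ[X]) : pairing t p q = pairing t q p := by
  simp only [pairing, mul_comm]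

theorem pairing_add_left (t : ℝ) (p q r : ℝ[X]) :
    pairing t (p + q) r = pairing t p r + pairing t q r := by
  unfold pairing
  rw [← integral_add (integrable_pairing t p r) (integrable_pairing t q r)]
  simp [add_mul]

theorem pairing_C_mul_left (t a : ℝ) (p r : ℝ[X]) :
    pairing t (C a * p) r = a * pairing t p r := by
  unfold pairing
  rw [← integral_const_mul]
  simp [mul_assoc]

theorem pairing_self_pos (t : ℝ) {p : ℝ[X]} (hp : p ≠ 0) : 0 < pairing t p p := by
  obtain ⟨x, hx⟩ : ∃ x, p.eval x ≠ 0 := by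
    by_contra! h
    exact hp (Polynomial.funext fun x => by simpa using h x)
  refine integral_pos_of_integrable_nonneg_nonzero (x := x) (by unfold weight; fun_prop)
    (integrable_pairing t p p) (fun y => mul_nonneg (mul_self_nonneg _) (Real.exp_pos _).le) ?_
  exact mul_ne_zero (mul_self_ne_zero.2 hx) (Real.exp_pos _).ne'

theorem pairing_sum_left (t : ℝ) {ι : Type} (s : Finset ι) (f : ι → ℝ[X]) (r : ℝ[X]) :
    pairing t (∑ i ∈ s, f i) r = ∑ i ∈ s, pairing t (f i) r := by
  classical
  induction s using Finset.induction_on with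
  | empty => simp [pairing]
  | insert a s ha ih => rw [Finset.sum_insert ha, Finset.sum_insert ha, pairing_add_left, ih]

/-- The monic orthogonal polynomials, by Gram-Schmidt from the powers of `x`. -/
def gramSchmidtPoly (t : ℝ) (n : ℕ) : ℝ[X] :=
  X ^ n + ∑ k : Fin n, C (-(pairing t (X ^ n) (gramSchmidtPoly t k) /
    pairing t (gramSchmidtPoly t k) (gramSchmidtPoly t k))) * gramSchmidtPoly t k
termination_by n
decreasing_by all_goals exact k.2

theorem gramSchmidtPoly_spec (t : ℝ) (n : ℕ) :
    (gramSchmidtPoly t n).Monic ∧ (gramSchmidtPoly t n).natDegree = n ∧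
      ∀ j < n, pairing t (gramSchmidtPoly t n) (gramSchmidtPoly t j) = 0 := by
  induction n using Nat.strong_induction_on with
  | _ n ih =>
    have hdeg : (∑ k : Fin n, C (-(pairing t (X ^ n) (gramSchmidtPoly t k) /
        pairing t (gramSchmidtPoly t k) (gramSchmidtPoly t k))) * gramSchmidtPoly t k).degree
        < (n : WithBot ℕ) := by
      rw [← Polynomial.mem_degreeLT]
      refine Submodule.sum_mem _ fun k _ => ?_
      rw [← smul_eq_C_mul]
      refine Submodule.smul_mem _ _ ?_
      rw [Polynomial.mem_degreeLT, degree_eq_natDegree (ih k k.2).1.ne_zero, (ih k k.2).2.1]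
      exact_mod_cast k.2
    refine ⟨?_, ?_, ?_⟩
    · rw [gramSchmidtPoly]
      exact monic_X_pow_add hdeg
    · rw [gramSchmidtPoly]
      refine natDegree_eq_of_degree_eq_some ?_
      rw [degree_add_eq_left_of_degree_lt (by rwa [degree_X_pow]), degree_X_pow]
    · intro j hj
      rw [gramSchmidtPoly, pairing_add_left, pairing_sum_left,
        Finset.sum_eq_single (⟨j, hj⟩ : Fin n)]
      · have h := (pairing_self_pos t (ih j hj).1.ne_zero).ne'
        rw [pairing_C_mul_left]
        field_simp
        ring
      · intro k _ hk
        have hkj : (k : ℕ) ≠ j := fun h => hk (Fin.ext h)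
        rw [pairing_C_mul_left]
        rcases lt_or_gt_of_ne hkj with h | h
        · rw [pairing_comm t (gramSchmidtPoly t k) (gramSchmidtPoly t j), (ih j hj).2.2 k h,
            mul_zero]
        · rw [(ih k k.2).2.2 j h, mul_zero]
      · intro h
        exact absurd (Finset.mem_univ _) h

theorem exists_isMonicOPS (t : ℝ) : ∃ P, IsMonicOPS t P := by
  refine ⟨gramSchmidtPoly t, fun n => (gramSchmidtPoly_spec t n).1,
    fun n => (gramSchmidtPoly_spec t n).2.1, fun j k hjk => ?_⟩
  rcases lt_or_gt_of_ne hjk with h | h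
  · rw [pairing_comm, (gramSchmidtPoly_spec t k).2.2 j h]
  · exact (gramSchmidtPoly_spec t j).2.2 k h

end Freud

end

/-! ### Integration by parts, parity and orthogonality. -/

namespace Freud

/-! The algebra rests on two facts. The weight is even, which gives the three-term recurrence
without a diagonal term, and `w' = (-4x³ + 2tx) w`. Integrating `(P (n+1) * P n * w)'` therefore
yields the string equation `4 β_n (β_{n-1} + β_n + β_{n+1}) - 2t β_n = n` (`string_equation`).
Comparing coefficients in the recurrence gives `p(n+1) = p(n) - β_n`. This telescopes, by the string
equation, to `p(n) = -(n-1) β_n / 2 - 2 β_{n-1} β_n β_{n+1}` (`subleading_eq_triple`), and one more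
use of the string equation gives the stated closed form.

For the asymptotics put `s = √(n/12)` and `d = 1/s`. Positivity of `β` and the string equation force
`β_n ~ s` (`tendsto_div_scale`). An explicit polynomial `profile` satisfies the rescaled string
equation up to `O(d^8)`, so `a_n = s * profile(d)` is an approximate solution with residual
`O(d^6)`. Subtracting the two string equations, the error `e_n = β_n - a_n` satisfies `|e_n| ≤ c
(|e_{n-1}| + |e_{n+1}|) + O(d^7)`, with `c` near `1/4`. Since `2c < 1`, a discrete maximum principle
(`isBigO_of_le_add_shift`) gives `e_n = O(d^7)`. In the triple-product formula this costs two
factors of `s`, leaving `O(d^5) = O(n^(-5/2))`. -/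

theorem weight_neg (t x : ℝ) : weight t (-x) = weight t x := by
  unfold weight; congr 1; ring

theorem hasDerivAt_weight (t x : ℝ) :
    HasDerivAt (weight t) ((-4 * x ^ 3 + 2 * t * x) * weight t x) x := by
  have h : HasDerivAt (fun x : ℝ => -x ^ 4 + t * x ^ 2) (-4 * x ^ 3 + 2 * t * x) x := by
    have := ((hasDerivAt_pow 4 x).neg).add ((hasDerivAt_pow 2 x).const_mul t)
    convert! this using 1
    push_cast; ring
  have := h.exp
  rw [mul_comm]
  exact this

/-- Integration by parts against the weight. -/
theorem integral_derivative_mul_weight (t : ℝ) (p : ℝ[X]) :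
    ∫ x, (derivative p).eval x * weight t x =
      ∫ x, ((C 4 * X ^ 3 - C (2 * t) * X) * p).eval x * weight t x := by
  have key : ∫ x, ((derivative p - (C 4 * X ^ 3 - C (2 * t) * X) * p).eval x * weight t x) = 0 := by
    refine integral_eq_zero_of_hasDerivAt_of_integrable (f := fun x => p.eval x * weight t x)
      (fun x => ?_) (integrable_eval_mul_weight t _) (integrable_eval_mul_weight t p)
    convert! (p.hasDerivAt x).mul (hasDerivAt_weight t x) using 1
    simp only [eval_sub, eval_mul, eval_C, eval_pow, eval_X]
    ring
  simp only [eval_sub, sub_mul] at key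
  rw [integral_sub (integrable_eval_mul_weight t _)] at key
  · simp only [eval_mul, eval_sub, eval_C, eval_pow, eval_X, sub_mul] at key ⊢
    linarith
  · have := integrable_eval_mul_weight t ((C 4 * X ^ 3 - C (2 * t) * X) * p)
    simpa only [eval_mul, eval_sub, sub_mul] using this

theorem pairing_add_right (t : ℝ) (p q r : ℝ[X]) :
    pairing t p (q + r) = pairing t p q + pairing t p r := by
  rw [pairing_comm, pairing_add_left, pairing_comm t q, pairing_comm t r]

theorem pairing_C_mul_right (t a : ℝ) (p r : ℝ[X]) :
    pairing t p (C a * r) = a * pairing t p r := by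
  rw [pairing_comm, pairing_C_mul_left, pairing_comm t r]

theorem pairing_sub_left (t : ℝ) (p q r : ℝ[X]) :
    pairing t (p - q) r = pairing t p r - pairing t q r := by
  have := pairing_add_left t (p - q) q r
  rw [sub_add_cancel] at this
  linarith

theorem pairing_sub_right (t : ℝ) (p q r : ℝ[X]) :
    pairing t p (q - r) = pairing t p q - pairing t p r := by
  rw [pairing_comm, pairing_sub_left, pairing_comm t q, pairing_comm t r]

theorem pairing_mul_assoc (t : ℝ) (p q r : ℝ[X]) :
    pairing t (p * q) r = pairing t p (q * r) := by
  simp only [pairing, eval_mul, mul_assoc]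

theorem pairing_X_mul_left (t : ℝ) (p q : ℝ[X]) :
    pairing t (X * p) q = pairing t p (X * q) := by
  rw [mul_comm X p, pairing_mul_assoc]

theorem pairing_comp_neg_X (t : ℝ) (p q : ℝ[X]) :
    pairing t (p.comp (-X)) (q.comp (-X)) = pairing t p q := by
  unfold pairing
  rw [← integral_neg_eq_self (fun x => p.eval x * q.eval x * weight t x)]
  simp [weight_neg]

/-- The formula of integration by parts, for the pairing. -/
theorem pairing_derivative_add (t : ℝ) (p q : ℝ[X]) :
    pairing t (derivative p) q + pairing t p (derivative q) =
      4 * pairing t (X * (X * p)) (X * q) - 2 * t * pairing t (X * p) q := by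
  have h := integral_derivative_mul_weight t (p * q)
  have h1 : ∫ x, (derivative (p * q)).eval x * weight t x =
      pairing t (derivative p * q + p * derivative q) 1 := by
    simp [pairing]
  have h2 : ∫ x, ((C 4 * X ^ 3 - C (2 * t) * X) * (p * q)).eval x * weight t x =
      pairing t (C 4 * (X * (X * p) * (X * q)) - C (2 * t) * (X * p * q)) 1 := by
    unfold pairing
    congr 1
    ext x
    simp only [eval_mul, eval_sub, eval_C, eval_pow, eval_X, eval_one]
    ring
  rw [h1, h2, pairing_add_left, pairing_sub_left, pairing_C_mul_left, pairing_C_mul_left,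
    pairing_mul_assoc, pairing_mul_assoc, pairing_mul_assoc t (X * (X * p)),
    pairing_mul_assoc t (X * p)] at h
  simpa only [mul_one] using h

theorem comp_neg_X_coeff (p : ℝ[X]) (m : ℕ) :
    (p.comp (-X)).coeff m = (-1) ^ m * p.coeff m := by
  have h : (-X : ℝ[X]) = C (-1) * X := by simp
  rw [h, comp_C_mul_X_coeff, mul_comm]

theorem degree_sub_C_mul_lt {p q : ℝ[X]} {n : ℕ} (hq : q.Monic) (hqn : q.natDegree = n)
    (hp : p.degree < ((n + 1 : ℕ) : WithBot ℕ)) :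
    (p - C (p.coeff n) * q).degree < (n : WithBot ℕ) := by
  rw [degree_lt_iff_coeff_zero] at hp ⊢
  intro m hm
  rcases hm.eq_or_lt with rfl | h
  · have : q.coeff n = 1 := by rw [← hqn]; exact hq
    simp [this]
  · rw [coeff_sub, coeff_C_mul, hp m h, coeff_eq_zero_of_natDegree_lt (p := q) (by omega)]
    simp

namespace IsMonicOPS

variable {t : ℝ} {P : ℕ → ℝ[X]}

theorem coeff_self (hP : IsMonicOPS t P) (n : ℕ) : (P n).coeff n = 1 := by
  have := hP.monic n
  rwa [Monic, leadingCoeff, hP.natDegree_eq] at this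

theorem coeff_eq_zero (hP : IsMonicOPS t P) {n m : ℕ} (h : n < m) : (P n).coeff m = 0 :=
  coeff_eq_zero_of_natDegree_lt (by rwa [hP.natDegree_eq])

theorem pairing_eq_zero (hP : IsMonicOPS t P) {n m : ℕ} (hnm : n ≤ m) {p : ℝ[X]}
    (hp : p.degree < (n : WithBot ℕ)) : pairing t (P m) p = 0 := by
  induction n generalizing p with
  | zero =>
    have : p = 0 := by simpa [← degree_eq_bot, Nat.WithBot.lt_zero_iff] using hp
    simp [this, pairing]
  | succ n ih =>
    have h1 := ih (by omega) (degree_sub_C_mul_lt (hP.monic n) (hP.natDegree_eq n) hp)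
    rw [pairing_sub_right, pairing_C_mul_right, hP.orthogonal m n (by omega)] at h1
    linarith

theorem pairing_eq_coeff_mul (hP : IsMonicOPS t P) {n : ℕ} {p : ℝ[X]}
    (hp : p.degree < ((n + 1 : ℕ) : WithBot ℕ)) :
    pairing t (P n) p = p.coeff n * pairing t (P n) (P n) := by
  have h1 := hP.pairing_eq_zero le_rfl
    (degree_sub_C_mul_lt (hP.monic n) (hP.natDegree_eq n) hp)
  rw [pairing_sub_right, pairing_C_mul_right] at h1
  linarith

theorem norm_pos (hP : IsMonicOPS t P) (n : ℕ) : 0 < pairing t (P n) (P n) :=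
  pairing_self_pos t (hP.monic n).ne_zero

/-- The weight is even, so the monic orthogonal polynomials have the parity of their degree. -/
theorem comp_neg_X (hP : IsMonicOPS t P) (n : ℕ) : C ((-1) ^ n) * (P n).comp (-X) = P n := by
  -- The leading terms cancel, so `D` has degree below `n`. It is then orthogonal to `P n` and, by
  -- reflection invariance of the pairing, to `P n (-x)`; hence to itself.
  set D := P n - C ((-1) ^ n) * (P n).comp (-X) with hD
  have hcoeff : ∀ m, D.coeff m = (1 - (-1) ^ n * (-1) ^ m) * (P n).coeff m := by
    intro m
    simp only [hD, coeff_sub, coeff_C_mul, comp_neg_X_coeff]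
    ring
  have hdeg : D.degree < (n : WithBot ℕ) := by
    rw [degree_lt_iff_coeff_zero]
    intro m hm
    rcases hm.eq_or_lt with rfl | h
    · rw [hcoeff, ← mul_pow]; simp
    · rw [hcoeff, hP.coeff_eq_zero h, mul_zero]
  have hdeg' : (D.comp (-X)).degree < (n : WithBot ℕ) := by
    rw [degree_lt_iff_coeff_zero] at hdeg ⊢
    intro m hm
    rw [comp_neg_X_coeff, hdeg m hm, mul_zero]
  have h1 : pairing t ((P n).comp (-X)) D = 0 := by
    have := pairing_comp_neg_X t ((P n).comp (-X)) D
    rw [← this, comp_assoc]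
    simpa using hP.pairing_eq_zero le_rfl hdeg'
  by_contra hne
  have hD0 : D ≠ 0 := fun h => hne (sub_eq_zero.1 h).symm
  have h2 := pairing_self_pos t hD0
  nth_rewrite 1 [hD] at h2
  rw [pairing_sub_left, pairing_C_mul_left, h1, hP.pairing_eq_zero le_rfl hdeg] at h2
  simp at h2

theorem coeff_pred (hP : IsMonicOPS t P) (n : ℕ) : (P (n + 1)).coeff n = 0 := by
  have h := congrArg (fun p => p.coeff n) (hP.comp_neg_X (n + 1))
  simp only [coeff_C_mul, comp_neg_X_coeff] at h
  have h2 : ((-1 : ℝ) ^ (n + 1)) * (-1) ^ n = -1 := by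
    rw [pow_succ, mul_right_comm, ← mul_pow]; simp
  rw [← mul_assoc, h2] at h
  linarith

theorem degree_lt_succ (hP : IsMonicOPS t P) (n : ℕ) :
    (P n).degree < ((n + 1 : ℕ) : WithBot ℕ) := by
  rw [degree_lt_iff_coeff_zero]
  exact fun m hm => hP.coeff_eq_zero hm

end IsMonicOPS

/-! ### Three-term recurrence, string equation and the subleading coefficient. -/

/-- The recurrence coefficients, as ratios of the squared norms. -/
noncomputable def recurrenceCoeff (t : ℝ) (P : ℕ → ℝ[X]) : ℕ → ℝ
  | 0 => 0
  | n + 1 => pairing t (P (n + 1)) (P (n + 1)) / pairing t (P n) (P n)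

namespace IsMonicOPS

variable {t : ℝ} {P : ℕ → ℝ[X]}

theorem recurrenceCoeff_mul (hP : IsMonicOPS t P) (n : ℕ) :
    recurrenceCoeff t P (n + 1) * pairing t (P n) (P n) = pairing t (P (n + 1)) (P (n + 1)) :=
  div_mul_cancel₀ _ (hP.norm_pos n).ne'

theorem recurrenceCoeff_pos (hP : IsMonicOPS t P) (n : ℕ) : 0 < recurrenceCoeff t P (n + 1) :=
  div_pos (hP.norm_pos _) (hP.norm_pos _)

/-- Monicity and parity make the defect `D` of the recurrence of degree at most `n`. Moving `X`
across the pairing, `⟨D, D⟩` is the coefficient of `x^n` in `D` times `‖P (n+1)‖² - β (n+1) ‖P n‖²`,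
which is zero by the choice of `β`. -/
theorem isRecurrenceCoeff (hP : IsMonicOPS t P) :
    IsRecurrenceCoeff P (recurrenceCoeff t P) where
  zero := rfl
  first := by
    have h0 : P 0 = 1 := (hP.monic 0).natDegree_eq_zero.1 (hP.natDegree_eq 0)
    rw [h0, mul_one]
    ext m
    rcases m with _ | _ | m
    · rw [hP.coeff_pred 0]; simp
    · rw [hP.coeff_self 1]; simp
    · rw [hP.coeff_eq_zero (by omega), coeff_X_of_ne_one (by omega)]
  succ n := by
    set D := X * P (n + 1) - P (n + 2) - C (recurrenceCoeff t P (n + 1)) * P n with hD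
    have hdeg : D.degree < ((n + 1 : ℕ) : WithBot ℕ) := by
      rw [degree_lt_iff_coeff_zero]
      intro m hm
      obtain ⟨m, rfl⟩ : ∃ k, m = k + 1 := ⟨m - 1, by omega⟩
      rw [hD, coeff_sub, coeff_sub, coeff_C_mul, coeff_X_mul, hP.coeff_eq_zero (n := n) (by omega)]
      rcases (show n ≤ m by omega).eq_or_lt with rfl | h
      · rw [hP.coeff_pred, hP.coeff_pred]; simp
      · rcases (show n + 1 ≤ m by omega).eq_or_lt with rfl | h
        · rw [hP.coeff_self, hP.coeff_self]; simp
        · rw [hP.coeff_eq_zero (by omega), hP.coeff_eq_zero (by omega)]; simp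
    have hdeg' : (X * D).degree < ((n + 1 + 1 : ℕ) : WithBot ℕ) := by
      rw [degree_lt_iff_coeff_zero] at hdeg ⊢
      intro m hm
      obtain ⟨m, rfl⟩ : ∃ k, m = k + 1 := ⟨m - 1, by omega⟩
      rw [coeff_X_mul, hdeg m (by omega)]
    have h1 : pairing t D D = 0 := by
      nth_rewrite 1 [hD]
      rw [pairing_sub_left, pairing_sub_left, pairing_C_mul_left, pairing_X_mul_left,
        hP.pairing_eq_coeff_mul hdeg', hP.pairing_eq_coeff_mul hdeg,
        hP.pairing_eq_zero (m := n + 2) (by omega) hdeg, coeff_X_mul, ← hP.recurrenceCoeff_mul n]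
      ring
    have h2 : D = 0 := by
      by_contra h
      exact (pairing_self_pos t h).ne' h1
    linear_combination h2

/-- The string equation (discrete Painlevé I) of the quartic Freud weight. -/
theorem string_equation (hP : IsMonicOPS t P) (n : ℕ) :
    4 * recurrenceCoeff t P (n + 1) * (recurrenceCoeff t P n + recurrenceCoeff t P (n + 1) +
      recurrenceCoeff t P (n + 2)) - 2 * t * recurrenceCoeff t P (n + 1) = n + 1 := by
  have hR := hP.isRecurrenceCoeff
  have hmul := hP.recurrenceCoeff_mul
  set β := recurrenceCoeff t P with hβ
  have hparts := pairing_derivative_add t (P (n + 1)) (P n)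
  have hd1 : (derivative (P (n + 1))).degree < ((n + 1 : ℕ) : WithBot ℕ) := by
    have := degree_derivative_lt (hP.monic (n + 1)).ne_zero
    rwa [degree_eq_natDegree (hP.monic (n + 1)).ne_zero, hP.natDegree_eq] at this
  have hd2 : (derivative (P n)).degree < ((n + 1 : ℕ) : WithBot ℕ) :=
    degree_derivative_le.trans_lt (hP.degree_lt_succ n)
  -- Only the leading coefficient `n + 1` of `(P (n+1))'` survives, so the left side becomes `(n+1)
  -- ‖P n‖²`.
  rw [pairing_comm, hP.pairing_eq_coeff_mul hd1, hP.pairing_eq_zero le_rfl hd2, coeff_derivative,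
    hP.coeff_self, add_zero, one_mul, pairing_X_mul_left t (P (n + 1)) (P n)] at hparts
  -- The last bracket stands for `β n * P (n-1)`; this form also covers `n = 0`, where it vanishes.
  have hXX : X * (X * P (n + 1)) = P (n + 3) + C (β (n + 2) + β (n + 1)) * P (n + 1) +
      C (β (n + 1)) * (X * P n - P (n + 1)) := by
    rw [hR.succ, mul_add, hR.succ, map_add]; ring
  have ho : ∀ j k, j ≠ k → pairing t (P j) (P k) = 0 := hP.orthogonal
  have hh := hP.norm_pos n
  have hm := hmul n
  rcases n with _ | n
  · rw [hXX, hR.first] at hparts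
    rw [sub_self, mul_zero, add_zero, pairing_add_left, pairing_C_mul_left,
      ho (0 + 3) (0 + 1) (by omega),
      ← hm] at hparts
    simp only [zero_add, hR.zero] at *
    have : pairing t (P 0) (P 0) * (4 * β 1 * (β 1 + β 2) - 2 * t * β 1 - 1) = 0 := by
      push_cast at hparts
      linear_combination -hparts
    have := (mul_eq_zero.1 this).resolve_left hh.ne'
    push_cast
    linear_combination this
  · rw [hXX, hR.succ n] at hparts
    rw [add_sub_cancel_left] at hparts
    simp only [pairing_add_left, pairing_add_right, pairing_C_mul_left, pairing_C_mul_right] at hparts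
    rw [ho _ _ (show n + 1 + 3 ≠ n + 2 by omega), ho _ _ (show n + 1 + 3 ≠ n by omega),
      ho (n + 1 + 1) n (by omega), ho n (n + 2) (by omega)] at hparts
    have hm' := hmul n
    simp only [show n + 1 + 1 = n + 2 from rfl, show n + 1 + 2 = n + 3 from rfl] at *
    have : pairing t (P (n + 1)) (P (n + 1)) * (4 * β (n + 2) * (β (n + 1) + β (n + 2) + β (n + 3))
        - 2 * t * β (n + 2) - (n + 2)) = 0 := by
      push_cast at hparts
      linear_combination -hparts + (4 * (β (n + 2) + β (n + 3)) - 2 * t) * hm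
        - 4 * β (n + 2) * β (n + 1) * hm'
    have := (mul_eq_zero.1 this).resolve_left hh.ne'
    push_cast
    linear_combination this

theorem subleading_succ (hP : IsMonicOPS t P) (n : ℕ) :
    subleading P (n + 2) = subleading P (n + 1) - recurrenceCoeff t P (n + 1) := by
  have h := congrArg (fun p => p.coeff n) (hP.isRecurrenceCoeff.succ n)
  simp only [coeff_add, coeff_C_mul, hP.coeff_self, mul_one] at h
  have h1 : subleading P (n + 2) = (P (n + 2)).coeff n := by simp [subleading]
  have h2 : subleading P (n + 1) = (X * P (n + 1)).coeff n := by
    rcases n with _ | n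
    · simp [subleading]
    · simp [subleading]
  rw [h1, h2, h]
  ring

/-- The subleading coefficient as a product of three recurrence coefficients. -/
theorem subleading_eq_triple (hP : IsMonicOPS t P) (n : ℕ) :
    subleading P (n + 1) = -(n * recurrenceCoeff t P (n + 1)) / 2 -
      2 * recurrenceCoeff t P n * recurrenceCoeff t P (n + 1) * recurrenceCoeff t P (n + 2) := by
  induction n with
  | zero => simp [subleading, recurrenceCoeff]
  | succ n ih =>
    have h1 := hP.string_equation n
    have h2 := hP.string_equation (n + 1)
    rw [hP.subleading_succ, ih]
    push_cast at h2 ⊢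
    simp only [show n + 1 + 1 = n + 2 from rfl, show n + 1 + 2 = n + 3 from rfl] at *
    -- In this cross-combination the `t` terms and the terms symmetric in the two middle
    -- coefficients cancel, leaving the difference of consecutive triple products.
    linear_combination (recurrenceCoeff t P (n + 1)) / 2 * h2 -
      (recurrenceCoeff t P (n + 2)) / 2 * h1

theorem subleading_eq (hP : IsMonicOPS t P) (n : ℕ) :
    subleading P (n + 1) = 1 / 2 * recurrenceCoeff t P (n + 1)
      + t * recurrenceCoeff t P (n + 1) ^ 2
      - 2 * recurrenceCoeff t P (n + 1) * (recurrenceCoeff t P n + recurrenceCoeff t P (n + 1)) *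
        (recurrenceCoeff t P (n + 1) + recurrenceCoeff t P (n + 2)) := by
  rw [hP.subleading_eq_triple]
  linear_combination (recurrenceCoeff t P (n + 1)) / 2 * hP.string_equation n

end IsMonicOPS

end Freud

open scoped Topology

/-! ### Freud's limit argument and a discrete maximum principle. -/

namespace Freud

/-- Freud's argument: comparing upper and lower limits in the limiting string equation. -/
theorem tendsto_one_of_tendsto_mul_add {x : ℕ → ℝ} {M : ℝ} (h0 : ∀ᶠ n in atTop, 0 ≤ x n)
    (hM : ∀ᶠ n in atTop, x n ≤ M)
    (h : Tendsto (fun n => x n * (x (n - 1) + x n + x (n + 1))) atTop (𝓝 3)) :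
    Tendsto x atTop (𝓝 1) := by
  have hba : IsBoundedUnder (· ≤ ·) atTop x := ⟨M, by simpa using hM⟩
  have hbb : IsBoundedUnder (· ≥ ·) atTop x := ⟨0, by simpa using h0⟩
  set L := limsup x atTop with hL
  set l := liminf x atTop with hl
  have hlL : l ≤ L := liminf_le_limsup hba hbb
  have hl0 : 0 ≤ l := le_liminf_of_le hba.isCoboundedUnder_ge h0
  have hp : Tendsto (fun n : ℕ => n + 1) atTop atTop := tendsto_add_atTop_nat 1
  have hm : Tendsto (fun n : ℕ => n - 1) atTop atTop := tendsto_sub_atTop_nat 1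
  have hup : ∀ ε > 0, ∀ᶠ n in atTop, x n < L + ε := fun ε hε =>
    eventually_lt_of_limsup_lt (by linarith) hba
  have hlo : ∀ ε > 0, ∀ᶠ n in atTop, l - ε < x n := fun ε hε =>
    eventually_lt_of_lt_liminf (by linarith) hbb
  have hfu : ∀ ε > 0, ∃ᶠ n in atTop, L - ε < x n := fun ε hε =>
    frequently_lt_of_lt_limsup hbb.isCoboundedUnder_le (by linarith)
  have hfl : ∀ ε > 0, ∃ᶠ n in atTop, x n < l + ε := fun ε hε =>
    frequently_lt_of_liminf_lt hba.isCoboundedUnder_ge (by linarith)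
  have hd : ∀ ε > (0 : ℝ), ∀ᶠ n in atTop,
      |x n * (x (n - 1) + x n + x (n + 1)) - 3| < ε := fun ε hε => by
    simpa [Real.dist_eq] using (Metric.tendsto_nhds.1 h) ε hε
  -- Take indices where `x n` is within `ε` of its lower limit; both neighbours are eventually below
  -- `L + ε`. Then let `ε → 0`.
  have key1 : l * (l + 2 * L) ≥ 3 := by
    have hev : ∀ᶠ ε in 𝓝[>] (0 : ℝ), 3 - ε ≤ (l + ε) * (l + 2 * L + 3 * ε) := by
      filter_upwards [self_mem_nhdsWithin] with ε (hε : 0 < ε)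
      obtain ⟨n, hn, h1, h2, h3, h4, h5, h6⟩ := ((hfl ε hε).and_eventually
        ((hm.eventually (hup ε hε)).and ((hp.eventually (hup ε hε)).and ((hd ε hε).and
          (h0.and ((hm.eventually h0).and (hp.eventually h0))))))).exists
      have := (abs_lt.1 h3).1
      have : x n * (x (n - 1) + x n + x (n + 1)) ≤ (l + ε) * (l + 2 * L + 3 * ε) :=
        mul_le_mul hn.le (by linarith) (by linarith) (by linarith)
      linarith
    have hc : Tendsto (fun ε : ℝ => (l + ε) * (l + 2 * L + 3 * ε) - (3 - ε)) (𝓝[>] 0)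
        (𝓝 ((l + 0) * (l + 2 * L + 3 * 0) - (3 - 0))) :=
      (Continuous.tendsto (by fun_prop) 0).mono_left nhdsWithin_le_nhds
    have := ge_of_tendsto hc (hev.mono fun ε hε => sub_nonneg.2 hε)
    linarith
  have hL0 : 0 < L := by
    by_contra hneg
    have hl' : l = 0 := by linarith
    rw [hl'] at key1
    norm_num at key1
  have key2 : L * (L + 2 * l) ≤ 3 := by
    have hev : ∀ᶠ ε in 𝓝[>] (0 : ℝ), (L - ε) * (L + 2 * l - 3 * ε) ≤ 3 + ε := by
      filter_upwards [self_mem_nhdsWithin, nhdsWithin_le_nhds (Iio_mem_nhds (half_pos hL0)),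
        nhdsWithin_le_nhds (Iio_mem_nhds (show (0 : ℝ) < L / 3 by positivity))]
        with ε (hε : 0 < ε) (hε2 : ε < L / 2) (hε3 : ε < L / 3)
      obtain ⟨n, hn, h1, h2, h3, h4, h5, h6⟩ := ((hfu ε hε).and_eventually
        ((hm.eventually (hlo ε hε)).and ((hp.eventually (hlo ε hε)).and ((hd ε hε).and
          (h0.and ((hm.eventually h0).and (hp.eventually h0))))))).exists
      have := (abs_lt.1 h3).2
      have : (L - ε) * (L + 2 * l - 3 * ε) ≤ x n * (x (n - 1) + x n + x (n + 1)) :=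
        mul_le_mul hn.le (by linarith) (by linarith) (by linarith)
      linarith
    have hc : Tendsto (fun ε : ℝ => (3 + ε) - (L - ε) * (L + 2 * l - 3 * ε)) (𝓝[>] 0)
        (𝓝 ((3 + 0) - (L - 0) * (L + 2 * l - 3 * 0))) :=
      (Continuous.tendsto (by fun_prop) 0).mono_left nhdsWithin_le_nhds
    have := ge_of_tendsto hc (hev.mono fun ε hε => sub_nonneg.2 hε)
    linarith
  -- Subtracting the two bounds gives `L² ≤ l²`.
  have hLl : L = l := le_antisymm (by nlinarith) hlL
  have hL1 : L = 1 := by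
    rw [← hLl] at key1 key2
    nlinarith
  exact tendsto_of_liminf_eq_limsup (by rw [← hl, ← hLl, hL1]) (by rw [← hL, hL1]) hba hbb

/-- A discrete maximum principle: a subsolution of a contractive second-order difference
inequality which grows slower than `(3 / 2) ^ n` is dominated by the inhomogeneous term. -/
theorem isBigO_of_le_add_shift {u b : ℕ → ℝ} {C : ℝ} (hu0 : ∀ n, 0 ≤ u n)
    (hb0 : ∀ᶠ n in atTop, 0 < b n)
    (hb : ∀ᶠ n in atTop, b (n - 1) + b (n + 1) ≤ 3 * b n)
    (hu : ∀ᶠ n in atTop, u n ≤ 3 / 10 * (u (n - 1) + u (n + 1)) + C * b n)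
    (hgrowth : ∀ᶠ n in atTop, u n ≤ (3 / 2) ^ n) :
    u =O[atTop] b := by
  obtain ⟨N, hN⟩ := eventually_atTop.1 (hb0.and (hb.and (hu.and hgrowth)))
  -- With `K ≥ 10 C`, the terms `3/10 * 3 K b + C b` are absorbed by `K b`, so `u - K b` satisfies
  -- the homogeneous inequality. The other entry of the maximum handles the boundary index `N`.
  set K := max (10 * C) (u N / b N) with hK
  have hK1 : 10 * C ≤ K := le_max_left _ _
  have hK2 : u N ≤ K * b N := (div_le_iff₀ (hN N le_rfl).1).1 (le_max_right _ _)
  have hK0 : 0 ≤ K := (div_nonneg (hu0 N) (hN N le_rfl).1.le).trans (le_max_right _ _)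
  -- One application to the barrier `(3/2)^n` multiplies it by `3/10 * (2/3 + 3/2) = 65/100`.
  -- Iterating drives the bound to zero at each fixed `n`.
  have hiter : ∀ k n, N ≤ n → u n - K * b n ≤ (65 / 100) ^ k * (3 / 2) ^ n := by
    intro k
    induction k with
    | zero =>
      intro n hn
      have := mul_nonneg hK0 (hN n hn).1.le
      rw [pow_zero, one_mul]
      linarith [(hN n hn).2.2.2]
    | succ k ih =>
      intro n hn
      rcases hn.eq_or_lt with rfl | hlt
      · have : (0 : ℝ) ≤ (65 / 100) ^ (k + 1) * (3 / 2) ^ N := by positivity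
        linarith
      · obtain ⟨m, rfl⟩ : ∃ m, n = m + 1 := ⟨n - 1, by omega⟩
        have h1 := ih m (by omega)
        have h2 := ih (m + 2) (by omega)
        obtain ⟨h3, h4, h5, -⟩ := hN (m + 1) hn
        simp only [Nat.add_sub_cancel, show m + 1 + 1 = m + 2 from rfl] at h4 h5
        have h6 : K * (b m + b (m + 2)) ≤ K * (3 * b (m + 1)) := mul_le_mul_of_nonneg_left h4 hK0
        have h7 : 10 * C * b (m + 1) ≤ K * b (m + 1) := mul_le_mul_of_nonneg_right hK1 h3.le
        have h8 : (65 / 100 : ℝ) ^ (k + 1) * (3 / 2) ^ (m + 1) =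
            3 / 10 * ((65 / 100) ^ k * (3 / 2) ^ m + (65 / 100) ^ k * (3 / 2) ^ (m + 2)) := by
          ring
        rw [h8]
        linarith
  refine IsBigO.of_bound K ?_
  filter_upwards [eventually_ge_atTop N] with n hn
  rw [Real.norm_of_nonneg (hu0 n), Real.norm_of_nonneg (hN n hn).1.le]
  have hlim : Tendsto (fun k : ℕ => (65 / 100 : ℝ) ^ k * (3 / 2) ^ n) atTop (𝓝 (0 * (3 / 2) ^ n)) :=
    (tendsto_pow_atTop_nhds_zero_of_lt_one (by norm_num) (by norm_num)).mul_const _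
  have := ge_of_tendsto' hlim fun k => hiter k n hn
  linarith

/-! ### The scale `√(n/12)` and the leading asymptotics. -/

/-- The leading-order size `√(n / 12)` of the recurrence coefficients. -/
noncomputable def scale (n : ℕ) : ℝ := √((n : ℝ) / 12)

theorem scale_sq (n : ℕ) : 12 * scale n ^ 2 = n := by
  rw [scale, Real.sq_sqrt (by positivity)]; ring

theorem scale_pos {n : ℕ} (hn : 1 ≤ n) : 0 < scale n := by
  have : (0 : ℝ) < n := by exact_mod_cast hn
  exact Real.sqrt_pos.2 (by positivity)

theorem tendsto_scale : Tendsto scale atTop atTop :=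
  Real.tendsto_sqrt_atTop.comp (tendsto_natCast_atTop_atTop.atTop_div_const (by norm_num))

theorem tendsto_inv_scale : Tendsto (fun n => (scale n)⁻¹) atTop (𝓝 0) :=
  tendsto_inv_atTop_zero.comp tendsto_scale

theorem scale_succ {n : ℕ} (hn : 1 ≤ n) :
    scale (n + 1) = scale n * √(1 + 1 * (scale n)⁻¹ ^ 2 / 12) := by
  have hs := scale_pos hn
  have h : 1 + 1 * (scale n)⁻¹ ^ 2 / 12 = (((n + 1 : ℕ) : ℝ) / 12) / scale n ^ 2 := by
    push_cast
    rw [← scale_sq n]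
    field_simp
  rw [h, Real.sqrt_div' _ (by positivity), Real.sqrt_sq hs.le, mul_div_cancel₀ _ hs.ne']
  rfl

theorem scale_pred {n : ℕ} (hn : 1 ≤ n) :
    scale (n - 1) = scale n * √(1 + (-1) * (scale n)⁻¹ ^ 2 / 12) := by
  have hs := scale_pos hn
  have h : 1 + (-1) * (scale n)⁻¹ ^ 2 / 12 = (((n - 1 : ℕ) : ℝ) / 12) / scale n ^ 2 := by
    push_cast [hn]
    rw [← scale_sq n]
    field_simp
    ring
  rw [h, Real.sqrt_div' _ (by positivity), Real.sqrt_sq hs.le, mul_div_cancel₀ _ hs.ne']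
  rfl

theorem tendsto_sqrt_one_add_scale (σ : ℝ) :
    Tendsto (fun n => √(1 + σ * (scale n)⁻¹ ^ 2 / 12)) atTop (𝓝 1) := by
  have h : Tendsto (fun d : ℝ => √(1 + σ * d ^ 2 / 12)) (𝓝 0) (𝓝 √(1 + σ * 0 ^ 2 / 12)) :=
    Continuous.tendsto (by fun_prop) 0
  have h' := h.comp tendsto_inv_scale
  simpa only [Function.comp_def, ne_eq, OfNat.ofNat_ne_zero, not_false_eq_true, zero_pow, mul_zero,
    zero_div, add_zero, Real.sqrt_one] using h'

theorem tendsto_scale_succ_div : Tendsto (fun n => scale (n + 1) / scale n) atTop (𝓝 1) := by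
  refine (tendsto_sqrt_one_add_scale 1).congr' ?_
  filter_upwards [eventually_ge_atTop 1] with n hn
  rw [scale_succ hn, mul_div_cancel_left₀ _ (scale_pos hn).ne']

theorem tendsto_scale_pred_div : Tendsto (fun n => scale (n - 1) / scale n) atTop (𝓝 1) := by
  refine (tendsto_sqrt_one_add_scale (-1)).congr' ?_
  filter_upwards [eventually_ge_atTop 1] with n hn
  rw [scale_pred hn, mul_div_cancel_left₀ _ (scale_pos hn).ne']

/-- The positive solutions of the string equation are asymptotic to `√(n / 12)`. -/
theorem tendsto_div_scale {t : ℝ} {β : ℕ → ℝ} (hβ : ∀ n, 0 ≤ β n)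
    (hs : ∀ n, 1 ≤ n → 4 * β n * (β (n - 1) + β n + β (n + 1)) - 2 * t * β n = n) :
    Tendsto (fun n => β n / scale n) atTop (𝓝 1) := by
  set x : ℕ → ℝ := fun n => β n / scale n with hx
  have hx0 : ∀ n, 0 ≤ x n := fun n => div_nonneg (hβ n) (Real.sqrt_nonneg _)
  have hxβ : ∀ n, 1 ≤ n → β n = x n * scale n := fun n hn =>
    (div_mul_cancel₀ _ (scale_pos hn).ne').symm
  clear_value x
  -- Dropping the nonnegative neighbours leaves `4 β² ≤ n + 2tβ`, a quadratic bound on `x`.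
  have hM : ∀ᶠ n in atTop, x n ≤ 2 + |t| := by
    filter_upwards [eventually_ge_atTop 1, tendsto_scale.eventually_ge_atTop 1] with n hn hs1
    by_contra! hgt
    have h1 := hs n hn
    have h2 : 4 * β n * β n ≤ 4 * β n * (β (n - 1) + β n + β (n + 1)) :=
      mul_le_mul_of_nonneg_left (by linarith [hβ (n - 1), hβ (n + 1)]) (by linarith [hβ n])
    rw [← scale_sq n] at h1
    rw [hxβ n hn] at h1 h2
    set s := scale n
    have h3 : s * (4 * (x n) ^ 2 * s) ≤ s * (12 * s + 2 * t * x n) := by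
      nlinarith
    have h4 := le_of_mul_le_mul_left h3 (by linarith)
    have h5 : t * x n ≤ |t| * x n := mul_le_mul_of_nonneg_right (le_abs_self t) (hx0 n)
    have h6 : |t| * x n ≤ |t| * x n * s :=
      le_mul_of_one_le_right (mul_nonneg (abs_nonneg t) (hx0 n)) hs1
    have h7 : (4 * x n ^ 2) * s ≤ (12 + 2 * |t| * x n) * s := by linarith
    have h8 := le_of_mul_le_mul_right h7 (by linarith)
    nlinarith [abs_nonneg t]
  have hbx : ∀ᶠ n in atTop, |x n| ≤ 2 + |t| := by
    filter_upwards [hM] with n hn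
    rwa [abs_of_nonneg (hx0 n)]
  have hp : Tendsto (fun n : ℕ => n + 1) atTop atTop := tendsto_add_atTop_nat 1
  have hm : Tendsto (fun n : ℕ => n - 1) atTop atTop := tendsto_sub_atTop_nat 1
  have hzero : ∀ {f g : ℕ → ℝ}, (∀ᶠ n in atTop, |f n| ≤ 2 + |t|) → Tendsto g atTop (𝓝 0) →
      Tendsto (fun n => f n * g n) atTop (𝓝 0) := fun hf hg =>
    bdd_le_mul_tendsto_zero' (2 + |t|) hf hg
  refine tendsto_one_of_tendsto_mul_add (Eventually.of_forall hx0) hM ?_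
  -- `h1`, `h2` and `h3` are the corrections from measuring neighbours in their own scale and from
  -- the `t` term: bounded factors times null sequences.
  have h1 : Tendsto (fun n => x n * (x (n + 1) * (1 - scale (n + 1) / scale n))) atTop (𝓝 0) :=
    hzero hbx (hzero (hp.eventually hbx) (by simpa using tendsto_scale_succ_div.const_sub 1))
  have h2 : Tendsto (fun n => x n * (x (n - 1) * (1 - scale (n - 1) / scale n))) atTop (𝓝 0) :=
    hzero hbx (hzero (hm.eventually hbx) (by simpa using tendsto_scale_pred_div.const_sub 1))
  have h3 : Tendsto (fun n => x n * (t / 2 * (scale n)⁻¹)) atTop (𝓝 0) :=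
    hzero hbx (by simpa using tendsto_inv_scale.const_mul (t / 2))
  have h4 := ((h1.add h2).add h3).const_add 3
  simp only [add_zero] at h4
  refine h4.congr' ?_
  filter_upwards [eventually_ge_atTop 2] with n hn
  have e := hs n (by omega)
  rw [hxβ n (by omega), hxβ (n - 1) (by omega), hxβ (n + 1) (by omega), ← scale_sq n] at e
  have hsn : scale n ≠ 0 := (scale_pos (by omega)).ne'
  have : 4 * scale n ^ 2 * (3 + (x n * (x (n + 1) * (1 - scale (n + 1) / scale n)) +
      x n * (x (n - 1) * (1 - scale (n - 1) / scale n)) + x n * (t / 2 * (scale n)⁻¹))) =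
      4 * scale n ^ 2 * (x n * (x (n - 1) + x n + x (n + 1))) := by
    field_simp
    refine mul_left_cancel₀ (mul_ne_zero two_ne_zero hsn) ?_
    linear_combination -e
  exact mul_left_cancel₀ (by positivity) this

end Freud

/-! ### Formal expansion: Taylor polynomials of the profiles. -/

namespace Freud

/-- Taylor's formula of order four for the real powers of `1 + y`. -/
theorem one_add_rpow_sub_taylor_isBigO (a : ℝ) :
    (fun y : ℝ => (1 + y) ^ a -
      (1 + a * y + a * (a - 1) / 2 * y ^ 2 + a * (a - 1) * (a - 2) / 6 * y ^ 3))
      =O[𝓝 0] fun y => y ^ 4 := by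
  have h := (Real.one_add_rpow_hasFPowerSeriesAt_zero (a := a)).isBigO_sub_partialSum_pow 4
  refine (h.congr_left fun y => ?_).trans (IsBigO.of_bound 1 ?_)
  · simp only [zero_add, FormalMultilinearSeries.partialSum, Finset.sum_range_succ,
      Finset.sum_range_zero, binomialSeries_apply, Ring.choose_eq_smul, smul_eq_mul,
      descPochhammer_succ_right, descPochhammer_zero]
    have h2 : (2 : ℤ[X]).smeval a = 2 := by
      simpa using Polynomial.smeval_natCast ℤ a 2
    simp [Polynomial.smeval_mul, Polynomial.smeval_sub, Polynomial.smeval_X,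
      Polynomial.smeval_one, Nat.factorial, h2]
    ring
  · exact Eventually.of_forall fun y => by simp

/-- The profile `F` for which `s * F (1 / s)`, with `s = √(n / 12)`, is the truncated expansion
of the recurrence coefficient. -/
noncomputable def profile (t d : ℝ) : ℝ :=
  1 + 1 / 12 * t * d + 1 / 288 * t ^ 2 * d ^ 2 + (1 / 3456 - 1 / 165888 * t ^ 4) * d ^ 4 +
      1 / 41472 * t * d ^ 5 + ((-1 / 331776) * t ^ 2 + 1 / 47775744 * t ^ 6) * d ^ 6 - 1 /
      2985984 * t ^ 3 * d ^ 7

/-- The profile of the recurrence coefficient of index `n + σ`, in the scale of the index `n`. -/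
noncomputable def shiftedProfile (t σ d : ℝ) : ℝ :=
  √(1 + σ * d ^ 2 / 12) * profile t (d * (√(1 + σ * d ^ 2 / 12))⁻¹)

/-- The truncated expansion of `shiftedProfile` for `σ = 1` and `σ = -1`. -/
noncomputable def shiftedProfilePoly (t σ d : ℝ) : ℝ :=
  1 + 1 / 12 * t * d + (σ / 24 + 1 / 288 * t ^ 2) * d ^ 2 +
    (-1 / 1728 - σ / 6912 * t ^ 2 - 1 / 165888 * t ^ 4) * d ^ 4 + 1 / 41472 * t * d ^ 5 +
    (1 / 165888 * t ^ 2 + σ / 1327104 * t ^ 4 + 1 / 47775744 * t ^ 6) * d ^ 6 +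
    (-σ / 248832 * t - 1 / 2985984 * t ^ 3) * d ^ 7

/-- The profile of the subleading coefficient. -/
noncomputable def subleadingProfile (t d : ℝ) : ℝ :=
  (-8) - 1 * t * d + (1 / 2 - 1 / 12 * t ^ 2) * d ^ 2 + (1 / 24 * t - 1 / 216 * t ^ 3) * d
      ^ 3 + (1 / 288 + 1 / 576 * t ^ 2 - 1 / 6912 * t ^ 4) * d ^ 4 + 1 / 3456 * t * d ^ 5 + (1
      / 6912 - 1 / 82944 * t ^ 2 - 1 / 331776 * t ^ 4 + 1 / 5971968 * t ^ 6) * d ^ 6 + (1 /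
      82944 * t - 1 / 497664 * t ^ 3) * d ^ 7

theorem isBigO_pow_mul {f : ℝ → ℝ} (hf : Continuous f) (k : ℕ) :
    (fun d => d ^ k * f d) =O[𝓝 0] fun d => d ^ k := by
  simpa using (isBigO_refl (fun d : ℝ => d ^ k) (𝓝 0)).mul ((hf.tendsto 0).isBigO_one ℝ)

theorem tendsto_mul_sq_div (σ : ℝ) : Tendsto (fun d : ℝ => σ * d ^ 2 / 12) (𝓝 0) (𝓝 0) := by
  have : Tendsto (fun d : ℝ => σ * d ^ 2 / 12) (𝓝 0) (𝓝 (σ * 0 ^ 2 / 12)) :=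
    Continuous.tendsto (by fun_prop) 0
  simpa using this

theorem one_add_rpow_comp_isBigO (a σ : ℝ) :
    (fun d : ℝ => (1 + σ * d ^ 2 / 12) ^ a - (1 + a * (σ * d ^ 2 / 12) +
      a * (a - 1) / 2 * (σ * d ^ 2 / 12) ^ 2 + a * (a - 1) * (a - 2) / 6 * (σ * d ^ 2 / 12) ^ 3))
      =O[𝓝 0] fun d => d ^ 8 := by
  refine ((one_add_rpow_sub_taylor_isBigO a).comp_tendsto (tendsto_mul_sq_div σ)).trans ?_
  refine ((isBigO_refl (fun d : ℝ => d ^ 8) (𝓝 0)).const_mul_left ((σ / 12) ^ 4)).congr_left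
    fun d => ?_
  simp only [Function.comp_apply]
  ring

/-- Rescaling turns the `d^k` term of the profile into itself times `(1 + σ d²/12)^((1-k)/2)`, to
which the binomial expansion applies. The term `k = 1` is unchanged and `k = 3` is absent. The
restriction on `σ` allows `σ² = 1` in the coefficients. -/
theorem shiftedProfile_sub_isBigO (t : ℝ) {σ : ℝ} (hσ : σ = 1 ∨ σ = -1) :
    (fun d => shiftedProfile t σ d - shiftedProfilePoly t σ d) =O[𝓝 0] fun d => d ^ 8 := by
  have hmul : ∀ (a : ℝ) {f : ℝ → ℝ}, Continuous f →
      (fun d : ℝ => f d * ((1 + σ * d ^ 2 / 12) ^ a - (1 + a * (σ * d ^ 2 / 12) +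
        a * (a - 1) / 2 * (σ * d ^ 2 / 12) ^ 2 +
        a * (a - 1) * (a - 2) / 6 * (σ * d ^ 2 / 12) ^ 3))) =O[𝓝 0] fun d => d ^ 8 :=
    fun a f hf => by
      simpa using ((hf.tendsto 0).isBigO_one ℝ).mul (one_add_rpow_comp_isBigO a σ)
  have h1 := hmul (1 / 2) (f := fun _ => 1) continuous_const
  have h2 := hmul (-1 / 2) (f := fun d => 1 / 288 * t ^ 2 * d ^ 2) (by fun_prop)
  have h4 := hmul (-3 / 2) (f := fun d => (1 / 3456 - 1 / 165888 * t ^ 4) * d ^ 4) (by fun_prop)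
  have h5 := hmul (-4 / 2) (f := fun d => 1 / 41472 * t * d ^ 5) (by fun_prop)
  have h6 := hmul (-5 / 2)
    (f := fun d => (-1 / 331776 * t ^ 2 + 1 / 47775744 * t ^ 6) * d ^ 6) (by fun_prop)
  have h7 := hmul (-6 / 2) (f := fun d => -1 / 2985984 * t ^ 3 * d ^ 7) (by fun_prop)
  have hR := isBigO_pow_mul (f := fun d => 5 / 1327104 - 5 / 63700992 * t ^ 4
      - σ * 5 / 1146617856 * t ^ 6 + (1 / 1990656 * t + σ / 11943936 * t ^ 3) * d
      + (-σ * 35 / 95551488 - 35 / 382205952 * t ^ 2 + σ * 35 / 4586471424 * t ^ 4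
        + 35 / 55037657088 * t ^ 6) * d ^ 2
      + (-σ / 17915904 * t - 1 / 71663616 * t ^ 3) * d ^ 3
      + (σ * 35 / 3057647616 * t ^ 2 - σ * 35 / 440301256704 * t ^ 6) * d ^ 4
      + σ * 5 / 2579890176 * t ^ 3 * d ^ 5) (by fun_prop) 8
  refine ((((((h1.add h2).add h4).add h5).add h6).add h7).add hR).congr' ?_ EventuallyEq.rfl
  have hpos : ∀ᶠ d : ℝ in 𝓝 0, -1 < σ * d ^ 2 / 12 :=
    (tendsto_mul_sq_div σ).eventually (lt_mem_nhds (by norm_num))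
  filter_upwards [hpos] with d hd
  have hy : 0 < 1 + σ * d ^ 2 / 12 := by linarith
  have hg : √(1 + σ * d ^ 2 / 12) ≠ 0 := (Real.sqrt_pos.2 hy).ne'
  have hpow : ∀ k : ℕ, (1 + σ * d ^ 2 / 12) ^ (-(k : ℝ) / 2) = (√(1 + σ * d ^ 2 / 12))⁻¹ ^ k := by
    intro k
    generalize 1 + σ * d ^ 2 / 12 = y at hy
    rw [inv_pow, Real.sqrt_eq_rpow, ← Real.rpow_natCast, ← Real.rpow_mul hy.le,
      ← Real.rpow_neg hy.le]
    congr 1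
    ring
  have e2 := hpow 1
  have e4 := hpow 3
  have e5 := hpow 4
  have e6 := hpow 5
  have e7 := hpow 6
  push_cast at e2 e4 e5 e6 e7
  rw [e2, e4, e5, e6, e7, ← Real.sqrt_eq_rpow]
  have hexp : shiftedProfile t σ d = √(1 + σ * d ^ 2 / 12) + 1 / 12 * t * d +
      1 / 288 * t ^ 2 * d ^ 2 * (√(1 + σ * d ^ 2 / 12))⁻¹ ^ 1 +
      (1 / 3456 - 1 / 165888 * t ^ 4) * d ^ 4 * (√(1 + σ * d ^ 2 / 12))⁻¹ ^ 3 +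
      1 / 41472 * t * d ^ 5 * (√(1 + σ * d ^ 2 / 12))⁻¹ ^ 4 +
      (-1 / 331776 * t ^ 2 + 1 / 47775744 * t ^ 6) * d ^ 6 * (√(1 + σ * d ^ 2 / 12))⁻¹ ^ 5 +
      -1 / 2985984 * t ^ 3 * d ^ 7 * (√(1 + σ * d ^ 2 / 12))⁻¹ ^ 6 := by
    unfold shiftedProfile profile
    generalize √(1 + σ * d ^ 2 / 12) = g at hg
    field_simp
    ring
  rw [hexp, shiftedProfilePoly]
  generalize (√(1 + σ * d ^ 2 / 12))⁻¹ = g'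
  rcases hσ with rfl | rfl
  · ring
  · ring

theorem continuous_profile (t : ℝ) : Continuous (profile t) := by
  unfold profile; fun_prop

theorem continuous_shiftedProfilePoly (t σ : ℝ) : Continuous (shiftedProfilePoly t σ) := by
  unfold shiftedProfilePoly; fun_prop

/-- The profile solves the string equation up to order eight. -/
theorem string_profile_isBigO (t : ℝ) :
    (fun d => 4 * profile t d * (shiftedProfile t (-1) d + profile t d + shiftedProfile t 1 d)
      - 2 * t * d * profile t d - 12) =O[𝓝 0] fun d => d ^ 8 := by
  have hF := ((continuous_profile t).tendsto 0).isBigO_one ℝ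
  have h1 : (fun d => profile t d * (shiftedProfile t 1 d - shiftedProfilePoly t 1 d))
      =O[𝓝 0] fun d => d ^ 8 := by
    simpa using hF.mul (shiftedProfile_sub_isBigO t (Or.inl rfl))
  have h2 : (fun d => profile t d * (shiftedProfile t (-1) d - shiftedProfilePoly t (-1) d))
      =O[𝓝 0] fun d => d ^ 8 := by
    simpa using hF.mul (shiftedProfile_sub_isBigO t (Or.inr rfl))
  -- The exact remainder once the shifted profiles are replaced by polynomials: every coefficient
  -- below `d^8` cancels.
  have hR := isBigO_pow_mul (f := fun d =>
      (-1 / 995328) + 5 / 2293235712 * t ^ 8 - 1 / 31850496 * t ^ 5 * d + (1 / 35831808 * t ^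
      2 - 1 / 330225942528 * t ^ 10) * d ^ 2 + 5 / 82556485632 * t ^ 7 * d ^ 3 + ((-25 /
      82556485632) * t ^ 4 + 1 / 190210142896128 * t ^ 12) * d ^ 4 - 1 / 5944066965504 * t ^ 9
      * d ^ 5 + 1 / 743008370688 * t ^ 6 * d ^ 6) (by fun_prop) 8
  refine (((h1.add h2).const_mul_left 4).add hR).congr_left fun d => ?_
  generalize shiftedProfile t 1 d = g₁
  generalize shiftedProfile t (-1) d = g₂
  unfold profile shiftedProfilePoly
  ring

/-- The profile of the subleading coefficient, from the profile of the recurrence coefficient. -/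
theorem triple_profile_isBigO (t : ℝ) :
    (fun d => profile t d * (d ^ 2 - 12) / 2
      - 2 * shiftedProfile t (-1) d * profile t d * shiftedProfile t 1 d
      - subleadingProfile t d) =O[𝓝 0] fun d => d ^ 8 := by
  have hF := ((continuous_profile t).tendsto 0).isBigO_one ℝ
  have hp := shiftedProfile_sub_isBigO t (Or.inl rfl : (1 : ℝ) = 1 ∨ (1 : ℝ) = -1)
  have hm := shiftedProfile_sub_isBigO t (Or.inr rfl : (-1 : ℝ) = 1 ∨ (-1 : ℝ) = -1)
  have hm1 : (fun d => shiftedProfile t (-1) d - shiftedProfilePoly t (-1) d)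
      =O[𝓝 0] fun _ => (1 : ℝ) :=
    hm.trans (((continuous_pow 8).tendsto 0).isBigO_one ℝ)
  -- With `δ` the error of each shifted profile against its polynomial `Q`, the product differs from
  -- `Q₋ Q₊` by `δ₋ δ₊ + Q₋ δ₊ + Q₊ δ₋`.
  have h0 : (fun d => profile t d * ((shiftedProfile t (-1) d - shiftedProfilePoly t (-1) d) *
      (shiftedProfile t 1 d - shiftedProfilePoly t 1 d))) =O[𝓝 0] fun d => d ^ 8 := by
    simpa using hF.mul (hm1.mul hp)
  have h1 : (fun d => profile t d * (shiftedProfilePoly t (-1) d *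
      (shiftedProfile t 1 d - shiftedProfilePoly t 1 d))) =O[𝓝 0] fun d => d ^ 8 := by
    simpa using
      hF.mul ((((continuous_shiftedProfilePoly t (-1)).tendsto 0).isBigO_one ℝ).mul hp)
  have h2 : (fun d => profile t d * (shiftedProfilePoly t 1 d *
      (shiftedProfile t (-1) d - shiftedProfilePoly t (-1) d))) =O[𝓝 0] fun d => d ^ 8 := by
    simpa using
      hF.mul ((((continuous_shiftedProfilePoly t 1).tendsto 0).isBigO_one ℝ).mul hm)
  have hR := isBigO_pow_mul (f := fun d =>
      1 / 995328 - 1 / 663552 * t ^ 2 + 1 / 15925248 * t ^ 4 + 1 / 95551488 * t ^ 6 - 7 /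
      4586471424 * t ^ 8 + ((-1 / 1990656) * t - 1 / 5971968 * t ^ 3 + 17 / 573308928 * t ^ 5
      - 5 / 55037657088 * t ^ 9) * d + ((-5 / 71663616) * t ^ 2 + 23 / 13759414272 * t ^ 6 - 1
      / 1320903770112 * t ^ 10) * d ^ 2 + ((-13 / 3439853568) * t ^ 3 - 1 / 82556485632 * t ^
      7 + 1 / 7925422620672 * t ^ 11) * d ^ 3 + ((-1 / 5159780352) + 19 / 82556485632 * t ^ 4
      - 65 / 15850845241344 * t ^ 8 + 7 / 2282521714753536 * t ^ 12) * d ^ 4 + ((-1 /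
      5159780352) * t + 49 / 1981355655168 * t ^ 5 + 1 / 190210142896128 * t ^ 9 - 1 /
      4565043429507072 * t ^ 13) * d ^ 5 + (23 / 990677827584 * t ^ 2 - 5 / 5283615080448 * t
      ^ 6 + 61 / 4565043429507072 * t ^ 10 - 1 / 73040694872113152 * t ^ 14) * d ^ 6 + (191 /
      35664401793024 * t ^ 3 - 13 / 95105071448064 * t ^ 7 + 11 / 27390260577042432 * t ^ 11)
      * d ^ 7 + (83 / 285315214344192 * t ^ 4 - 37 / 27390260577042432 * t ^ 8 - 7 /
      657366253849018368 * t ^ 12 + 1 / 63107160369505763328 * t ^ 16) * d ^ 8 + ((-1 /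
      106993205379072) * t ^ 5 + 59 / 328683126924509184 * t ^ 9 - 1 / 1752976676930715648 * t
      ^ 13) * d ^ 9 + (1 / 106993205379072 * t ^ 2 - 23 / 41085390865563648 * t ^ 6 + 7 /
      2629465015396073472 * t ^ 10 + 1 / 63107160369505763328 * t ^ 14 - 1 /
      54524586559252979515392 * t ^ 18) * d ^ 10 + (1 / 1283918464548864 * t ^ 3 + 5 /
      246512345193381888 * t ^ 7 - 1 / 2629465015396073472 * t ^ 11 + 1 /
      1135928886651103739904 * t ^ 15) * d ^ 11 + ((-1 / 10271347716390912) * t ^ 4 + 1 /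
      369768517790072832 * t ^ 8 - 1 / 70995555415693983744 * t ^ 12) * d ^ 12 + ((-1 /
      92442129447518208) * t ^ 5 + 1 / 13311666640442621952 * t ^ 9) * d ^ 13) (by fun_prop) 8
  refine ((((h0.add h1).add h2).const_mul_left (-2)).add hR).congr_left fun d => ?_
  generalize shiftedProfile t 1 d = g₁
  generalize shiftedProfile t (-1) d = g₂
  unfold profile shiftedProfilePoly subleadingProfile
  ring

end Freud

/-! ### From the approximate solution to the true recurrence coefficients. -/

namespace Freud

/-- The truncated expansion of the recurrence coefficient. -/
noncomputable def approx (t : ℝ) (n : ℕ) : ℝ := scale n * profile t (scale n)⁻¹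

theorem approx_succ (t : ℝ) {n : ℕ} (hn : 1 ≤ n) :
    approx t (n + 1) = scale n * shiftedProfile t 1 (scale n)⁻¹ := by
  rw [approx, shiftedProfile, scale_succ hn, mul_inv, mul_assoc]

theorem approx_pred (t : ℝ) {n : ℕ} (hn : 1 ≤ n) :
    approx t (n - 1) = scale n * shiftedProfile t (-1) (scale n)⁻¹ := by
  rw [approx, shiftedProfile, scale_pred hn, mul_inv, mul_assoc]

theorem tendsto_approx_div_scale (t : ℝ) :
    Tendsto (fun n => approx t n / scale n) atTop (𝓝 1) := by
  have h := ((continuous_profile t).tendsto 0).comp tendsto_inv_scale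
  have h0 : profile t 0 = 1 := by simp [profile]
  rw [h0] at h
  refine h.congr' ?_
  filter_upwards [eventually_ge_atTop 1] with n hn
  rw [approx, mul_div_cancel_left₀ _ (scale_pos hn).ne', Function.comp_apply]

theorem tendsto_succ_div_scale {f : ℕ → ℝ}
    (hf : Tendsto (fun n => f n / scale n) atTop (𝓝 1)) :
    Tendsto (fun n => f (n + 1) / scale n) atTop (𝓝 1) := by
  have h := (hf.comp (tendsto_add_atTop_nat 1)).mul tendsto_scale_succ_div
  rw [one_mul] at h
  refine h.congr fun n => ?_
  exact div_mul_div_cancel₀ (scale_pos (show 1 ≤ n + 1 by omega)).ne'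

theorem tendsto_pred_div_scale {f : ℕ → ℝ}
    (hf : Tendsto (fun n => f n / scale n) atTop (𝓝 1)) :
    Tendsto (fun n => f (n - 1) / scale n) atTop (𝓝 1) := by
  have h := (hf.comp (tendsto_sub_atTop_nat 1)).mul tendsto_scale_pred_div
  rw [one_mul] at h
  refine h.congr' ?_
  filter_upwards [eventually_ge_atTop 2] with n hn
  exact div_mul_div_cancel₀ (scale_pos (show 1 ≤ n - 1 by omega)).ne'

/-- This is `s²` times the rescaled equation, since `n = 12 s²`; hence `s² d^8 = d^6`. -/
theorem string_approx_isBigO (t : ℝ) :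
    (fun n => 4 * approx t n * (approx t (n - 1) + approx t n + approx t (n + 1))
      - 2 * t * approx t n - n) =O[atTop] fun n => (scale n)⁻¹ ^ 6 := by
  have h := (isBigO_refl (fun n => scale n ^ 2) atTop).mul
    ((string_profile_isBigO t).comp_tendsto tendsto_inv_scale)
  refine h.congr' ?_ ?_
  · filter_upwards [eventually_ge_atTop 1] with n hn
    have hs := (scale_pos hn).ne'
    rw [approx_succ t hn, approx_pred t hn, approx, ← scale_sq n]
    simp only [Function.comp_apply]
    linear_combination (-2 * t * profile t (scale n)⁻¹ * scale n) * mul_inv_cancel₀ hs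
  · filter_upwards [eventually_ge_atTop 1] with n hn
    have hs := (scale_pos hn).ne'
    simp only [Function.comp_apply]
    field_simp

theorem tendsto_inv_scale_pow_succ_div (k : ℕ) :
    Tendsto (fun n => (scale (n + 1))⁻¹ ^ k / (scale n)⁻¹ ^ k) atTop (𝓝 1) := by
  have h := (tendsto_scale_succ_div.inv₀ one_ne_zero).pow k
  rw [inv_one, one_pow] at h
  refine h.congr fun n => ?_
  rw [← div_pow, inv_div, inv_div_inv]

theorem tendsto_inv_scale_pow_pred_div (k : ℕ) :
    Tendsto (fun n => (scale (n - 1))⁻¹ ^ k / (scale n)⁻¹ ^ k) atTop (𝓝 1) := by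
  have h := (tendsto_scale_pred_div.inv₀ one_ne_zero).pow k
  rw [inv_one, one_pow] at h
  refine h.congr fun n => ?_
  rw [← div_pow, inv_div, inv_div_inv]

theorem eventually_scale_le_pow : ∀ᶠ n in atTop, scale n ≤ (3 / 2) ^ n := by
  filter_upwards [tendsto_scale.eventually_ge_atTop 1] with n hn
  have h1 := scale_sq n
  have h2 : 1 + (n : ℝ) * (1 / 2) ≤ (1 + 1 / 2) ^ n := one_add_mul_le_pow (by norm_num) n
  rw [show (1 + 1 / 2 : ℝ) = 3 / 2 by norm_num] at h2
  nlinarith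

/-- A positive solution of the string equation agrees with the truncated expansion up to an error
of order `n ^ (-7 / 2)`. -/
theorem sub_approx_isBigO {t : ℝ} {β : ℕ → ℝ} (hβ : ∀ n, 0 ≤ β n)
    (hs : ∀ n, 1 ≤ n → 4 * β n * (β (n - 1) + β n + β (n + 1)) - 2 * t * β n = n) :
    (fun n => β n - approx t n) =O[atTop] fun n => (scale n)⁻¹ ^ 7 := by
  have hβ1 := tendsto_div_scale hβ hs
  have ha1 := tendsto_approx_div_scale t
  obtain ⟨C, hC0, hC⟩ := (string_approx_isBigO t).exists_nonneg
  have hD : Tendsto (fun n => approx t (n - 1) / scale n + approx t n / scale n +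
      approx t (n + 1) / scale n + β n / scale n - t / 2 * (scale n)⁻¹) atTop
      (𝓝 (1 + 1 + 1 + 1 - t / 2 * 0)) :=
    ((((tendsto_pred_div_scale ha1).add ha1).add (tendsto_succ_div_scale ha1)).add hβ1).sub
      (tendsto_inv_scale.const_mul _)
  have he : Tendsto (fun n => |β n / scale n - approx t n / scale n|) atTop (𝓝 |1 - 1|) :=
    (hβ1.sub ha1).abs
  refine IsBigO.of_abs_left (isBigO_of_le_add_shift (C := C) (fun n => abs_nonneg _) ?_ ?_ ?_ ?_)
  · filter_upwards [eventually_ge_atTop 1] with n hn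
    have := scale_pos hn
    positivity
  · filter_upwards [eventually_ge_atTop 1,
      ((tendsto_inv_scale_pow_pred_div 7).add (tendsto_inv_scale_pow_succ_div 7)).eventually
        (ge_mem_nhds (show (1 : ℝ) + 1 < 3 by norm_num))] with n hn h
    have hb : 0 < (scale n)⁻¹ ^ 7 := by
      have := scale_pos hn
      positivity
    rwa [← add_div, div_le_iff₀ hb] at h
  -- `D / s → 4` and `β / s → 1`, so eventually `β / D ≤ 11/39 < 3/10`, the contraction constant
  -- required.
  · filter_upwards [eventually_ge_atTop 1, hC.bound,
      hD.eventually (le_mem_nhds (show (39 / 10 : ℝ) < 1 + 1 + 1 + 1 - t / 2 * 0 by norm_num)),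
      hβ1.eventually (ge_mem_nhds (show (1 : ℝ) < 11 / 10 by norm_num))] with n hn hr hDn hβn
    have hsp := scale_pos hn
    have e := hs n hn
    set r := 4 * approx t n * (approx t (n - 1) + approx t n + approx t (n + 1))
      - 2 * t * approx t n - n with hrdef
    set D := approx t (n - 1) + approx t n + approx t (n + 1) + β n - t / 2 with hDdef
    have hDs : 39 / 10 * scale n ≤ D := by
      rw [← div_eq_mul_inv, ← add_div, ← add_div, ← add_div, ← sub_div, le_div_iff₀ hsp] at hDn
      exact hDn
    have hβs : β n ≤ 11 / 10 * scale n := (div_le_iff₀ hsp).1 hβn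
    rw [Real.norm_eq_abs, Real.norm_of_nonneg (by positivity)] at hr
    -- A quarter of the difference of the exact and approximate string equations, solved for the
    -- error at `n`.
    have hmain : (β n - approx t n) * D =
        -(β n * ((β (n - 1) - approx t (n - 1)) + (β (n + 1) - approx t (n + 1)))) - r / 4 := by
      rw [hDdef, hrdef]
      linear_combination e / 4
    set u := |β n - approx t n|
    set v := |β (n - 1) - approx t (n - 1)|
    set w := |β (n + 1) - approx t (n + 1)|
    have h1 : u * D ≤ β n * (v + w) + |r| / 4 := by
      have hD0 : 0 ≤ D := le_trans (by positivity) hDs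
      rw [← abs_of_nonneg hD0, ← abs_mul, hmain]
      refine (abs_sub _ _).trans ?_
      rw [abs_neg, abs_mul, abs_of_nonneg (hβ n), abs_div, abs_of_pos (four_pos : (0 : ℝ) < 4)]
      have := abs_add_le (β (n - 1) - approx t (n - 1)) (β (n + 1) - approx t (n + 1))
      have := mul_le_mul_of_nonneg_left this (hβ n)
      linarith
    have hu0 : 0 ≤ u := abs_nonneg _
    have hv0 : 0 ≤ v := abs_nonneg _
    have hw0 : 0 ≤ w := abs_nonneg _
    have h2 : u * (39 / 10 * scale n) ≤ u * D := mul_le_mul_of_nonneg_left hDs hu0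
    have h3 : β n * (v + w) ≤ 11 / 10 * scale n * (v + w) :=
      mul_le_mul_of_nonneg_right hβs (by linarith)
    have h4 : (scale n)⁻¹ ^ 6 = (scale n)⁻¹ ^ 7 * scale n := by field_simp
    have h5 : 0 ≤ scale n * (v + w) := by positivity
    have h6 : 0 ≤ C * (scale n)⁻¹ ^ 7 * scale n := by positivity
    rw [h4] at hr
    have h7 : u * scale n ≤ (3 / 10 * (v + w) + C * (scale n)⁻¹ ^ 7) * scale n := by linarith
    exact le_of_mul_le_mul_right h7 hsp
  -- A priori growth: both sequences are asymptotic to `s`, so the error is eventually at most `s`,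
  -- far below `(3/2)^n`.
  · filter_upwards [eventually_ge_atTop 1, eventually_scale_le_pow,
      he.eventually (ge_mem_nhds (show |(1 : ℝ) - 1| < 1 by norm_num))] with n hn hpow h
    have hsp := scale_pos hn
    rw [← sub_div, abs_div, abs_of_pos hsp, div_le_one hsp] at h
    exact h.trans hpow

/-- The expansion of the product formula for the subleading coefficient. -/
theorem triple_sub_isBigO {t : ℝ} {β : ℕ → ℝ} (hβ : ∀ n, 0 ≤ β n)
    (hs : ∀ n, 1 ≤ n → 4 * β n * (β (n - 1) + β n + β (n + 1)) - 2 * t * β n = n) :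
    (fun n : ℕ => β n * (1 - n) / 2 - 2 * β (n - 1) * β n * β (n + 1)
      - scale n ^ 3 * subleadingProfile t (scale n)⁻¹) =O[atTop] fun n => (scale n)⁻¹ ^ 5 := by
  have hscale : ∀ {f : ℕ → ℝ}, Tendsto (fun n => f n / scale n) atTop (𝓝 1) →
      f =O[atTop] scale := fun {f} hf => by
    refine isBigO_of_div_tendsto_nhds ?_ 1 hf
    filter_upwards [eventually_ge_atTop 1] with n hn h
    exact absurd h (scale_pos hn).ne'
  have hβ1 := tendsto_div_scale hβ hs
  have ha1 := tendsto_approx_div_scale t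
  have he := sub_approx_isBigO hβ hs
  have hep : (fun n => β (n + 1) - approx t (n + 1)) =O[atTop] fun n => (scale n)⁻¹ ^ 7 := by
    refine (he.comp_tendsto (tendsto_add_atTop_nat 1)).trans ?_
    refine isBigO_of_div_tendsto_nhds ?_ 1 (tendsto_inv_scale_pow_succ_div 7)
    filter_upwards [eventually_ge_atTop 1] with n hn h
    exact absurd h (pow_ne_zero _ (inv_ne_zero (scale_pos hn).ne'))
  have hem : (fun n => β (n - 1) - approx t (n - 1)) =O[atTop] fun n => (scale n)⁻¹ ^ 7 := by
    refine (he.comp_tendsto (tendsto_sub_atTop_nat 1)).trans ?_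
    refine isBigO_of_div_tendsto_nhds ?_ 1 (tendsto_inv_scale_pow_pred_div 7)
    filter_upwards [eventually_ge_atTop 1] with n hn h
    exact absurd h (pow_ne_zero _ (inv_ne_zero (scale_pos hn).ne'))
  have hcancel : (fun n => (scale n)⁻¹ ^ 7 * (scale n * scale n)) =ᶠ[atTop]
      fun n => (scale n)⁻¹ ^ 5 := by
    filter_upwards [eventually_ge_atTop 1] with n hn
    have := (scale_pos hn).ne'
    field_simp
  have hn1 : (fun n : ℕ => (1 - (n : ℝ)) / 2) =O[atTop] fun n => scale n * scale n := by
    refine IsBigO.of_bound 12 ?_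
    filter_upwards [eventually_ge_atTop 1] with n hn
    have h1 : (1 : ℝ) ≤ n := by exact_mod_cast hn
    rw [Real.norm_of_nonpos (by linarith), Real.norm_of_nonneg (mul_self_nonneg _)]
    linarith [scale_sq n]
  -- `t1`, `t2`, `t3` replace `β` by its approximation one factor at a time in the triple product;
  -- `t0` does so in the linear term, and `t4` is the profile remainder.
  have t0 := (he.mul hn1).trans_eventuallyEq hcancel
  have t1 := (hem.mul ((hscale hβ1).mul (hscale (tendsto_succ_div_scale hβ1)))).trans_eventuallyEq
    hcancel
  have t2 := (he.mul ((hscale (tendsto_pred_div_scale ha1)).mul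
    (hscale (tendsto_succ_div_scale hβ1)))).trans_eventuallyEq hcancel
  have t3 := (hep.mul ((hscale (tendsto_pred_div_scale ha1)).mul (hscale ha1))).trans_eventuallyEq
    hcancel
  have t4 := (isBigO_refl (fun n => scale n ^ 3) atTop).mul
    ((triple_profile_isBigO t).comp_tendsto tendsto_inv_scale)
  have hcancel' : (fun n => scale n ^ 3 * ((fun d : ℝ => d ^ 8) ∘ fun n => (scale n)⁻¹) n)
      =ᶠ[atTop] fun n => (scale n)⁻¹ ^ 5 := by
    filter_upwards [eventually_ge_atTop 1] with n hn
    have := (scale_pos hn).ne'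
    simp only [Function.comp_apply]
    field_simp
  refine ((t0.add (((t1.add t2).add t3).const_mul_left (-2))).add
    (t4.trans_eventuallyEq hcancel')).congr' ?_ EventuallyEq.rfl
  filter_upwards [eventually_ge_atTop 1] with n hn
  have hsn := (scale_pos hn).ne'
  simp only [Function.comp_apply]
  rw [approx_succ t hn, approx_pred t hn, approx, ← scale_sq n]
  linear_combination (scale n * profile t (scale n)⁻¹ / 2 * (scale n * (scale n)⁻¹ + 1)) *
    mul_inv_cancel₀ hsn

/-! ### Back to powers of `n`. -/

theorem sqrt_natCast_eq_scale (n : ℕ) : √(n : ℝ) = 2 * √3 * scale n := by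
  have h : (n : ℝ) = (2 ^ 2 * 3) * (n / 12) := by ring
  rw [scale, h, Real.sqrt_mul (by norm_num), Real.sqrt_mul (by norm_num),
    Real.sqrt_sq (by norm_num)]
  congr 2
  ring

/-- The expansion in powers of `√n`, written in terms of `scale n`. -/
theorem expansion_eq (t : ℝ) {n : ℕ} (hn : 1 ≤ n) :
    -((n : ℝ) ^ (3 / 2 : ℝ) / (3 * √3))
        - (n : ℝ) * t / 12
        - (t ^ 2 - 6) * (n : ℝ) ^ (1 / 2 : ℝ) / (24 * √3)
        - t * (t ^ 2 - 9) / 216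
        - (t ^ 4 - 12 * t ^ 2 - 24) / (1152 * √3 * (n : ℝ) ^ (1 / 2 : ℝ))
        + t / (288 * (n : ℝ))
        + (t ^ 6 - 18 * t ^ 4 - 72 * t ^ 2 + 864) / (82944 * √3 * (n : ℝ) ^ (3 / 2 : ℝ))
        - t * (t ^ 2 - 6) / (3456 * (n : ℝ) ^ 2) =
      scale n ^ 3 * subleadingProfile t (scale n)⁻¹ := by
  have hs := scale_pos hn
  have hq : √(3 : ℝ) ^ 2 = 3 := Real.sq_sqrt (by norm_num)
  have hq0 : √(3 : ℝ) ≠ 0 := by positivity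
  have h1 : (n : ℝ) ^ (1 / 2 : ℝ) = 2 * √3 * scale n := by
    rw [← Real.sqrt_eq_rpow, sqrt_natCast_eq_scale]
  have h3 : (n : ℝ) ^ (3 / 2 : ℝ) = √3 * (24 * scale n ^ 3) := by
    rw [show (3 / 2 : ℝ) = 1 / 2 * (3 : ℕ) by norm_num, Real.rpow_mul (by positivity),
      Real.rpow_natCast, h1]
    linear_combination 8 * √3 * scale n ^ 3 * hq
  have d1 : 1152 * √3 * (2 * √3 * scale n) = 6912 * scale n := by
    linear_combination 2304 * scale n * hq
  have d3 : 82944 * √3 * (√3 * (24 * scale n ^ 3)) = 5971968 * scale n ^ 3 := by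
    linear_combination 1990656 * scale n ^ 3 * hq
  rw [h1, h3, d1, d3, ← scale_sq n, subleadingProfile]
  generalize scale n = s at hs
  field_simp
  ring

theorem inv_scale_pow_isBigO :
    (fun n => (scale n)⁻¹ ^ 5) =O[atTop] fun n : ℕ => (n : ℝ) ^ (-(5 / 2) : ℝ) := by
  refine IsBigO.of_bound ((2 * √3) ^ 5) ?_
  filter_upwards [eventually_ge_atTop 1] with n hn
  have hs := scale_pos hn
  have hq : 0 < √(3 : ℝ) := by positivity
  have h : (n : ℝ) ^ (-(5 / 2) : ℝ) = (√(n : ℝ))⁻¹ ^ 5 := by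
    rw [Real.sqrt_eq_rpow, ← Real.rpow_neg (by positivity), ← Real.rpow_natCast,
      ← Real.rpow_mul (by positivity)]
    norm_num
  rw [h, sqrt_natCast_eq_scale, Real.norm_of_nonneg (by positivity),
    Real.norm_of_nonneg (by positivity)]
  refine le_of_eq ?_
  field_simp

end Freud

theorem theorem2 (t : ℝ) (P : ℕ → ℝ[X]) (hP : Freud.IsMonicOPS t P) :
    (∃ β : ℕ → ℝ, Freud.IsRecurrenceCoeff P β ∧
      ∀ n : ℕ, 1 ≤ n →
        Freud.subleading P n = 1 / 2 * β n + t * β n ^ 2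
          - 2 * β n * (β (n - 1) + β n) * (β n + β (n + 1))) ∧
    (fun n : ℕ => Freud.subleading P n -
      (-((n : ℝ) ^ (3 / 2 : ℝ) / (3 * √3))
        - (n : ℝ) * t / 12
        - (t ^ 2 - 6) * (n : ℝ) ^ (1 / 2 : ℝ) / (24 * √3)
        - t * (t ^ 2 - 9) / 216
        - (t ^ 4 - 12 * t ^ 2 - 24) / (1152 * √3 * (n : ℝ) ^ (1 / 2 : ℝ))
        + t / (288 * (n : ℝ))
        + (t ^ 6 - 18 * t ^ 4 - 72 * t ^ 2 + 864) / (82944 * √3 * (n : ℝ) ^ (3 / 2 : ℝ))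
        - t * (t ^ 2 - 6) / (3456 * (n : ℝ) ^ 2)))
      =O[atTop] fun n : ℕ => (n : ℝ) ^ (-(5 / 2) : ℝ) := by
  refine ⟨⟨Freud.recurrenceCoeff t P, hP.isRecurrenceCoeff, fun n hn => ?_⟩, ?_⟩
  · obtain ⟨m, rfl⟩ : ∃ m, n = m + 1 := ⟨n - 1, by omega⟩
    exact hP.subleading_eq m
  · have hβ : ∀ n, 0 ≤ Freud.recurrenceCoeff t P n := by
      rintro (_ | n)
      · exact le_rfl
      · exact (hP.recurrenceCoeff_pos n).le
    have hs : ∀ n : ℕ, 1 ≤ n → 4 * Freud.recurrenceCoeff t P n *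
        (Freud.recurrenceCoeff t P (n - 1) + Freud.recurrenceCoeff t P n +
          Freud.recurrenceCoeff t P (n + 1)) - 2 * t * Freud.recurrenceCoeff t P n = n := by
      intro n hn
      obtain ⟨m, rfl⟩ : ∃ m, n = m + 1 := ⟨n - 1, by omega⟩
      push_cast
      exact hP.string_equation m
    refine ((Freud.triple_sub_isBigO hβ hs).congr' ?_ EventuallyEq.rfl).trans
      Freud.inv_scale_pow_isBigO
    filter_upwards [eventually_ge_atTop 1] with n hn
    rw [Freud.expansion_eq t hn]
    obtain ⟨m, rfl⟩ : ∃ m, n = m + 1 := ⟨n - 1, by omega⟩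
    rw [hP.subleading_eq_triple m]
    simp only [Nat.add_sub_cancel, show m + 1 + 1 = m + 2 from rfl]
    push_cast
    ring
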